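/- Let $\mathcal{E}$ be a finite-dimensional real inner product space, and let $\mathcal{K}\subseteq\mathcal{E}$ be a full-dimensional closed convex cone that is \emph{amenable}: for every face $\mathcal{F}$ of $\mathcal{K}$ there is a constant $c$ with $\mathrm{dist}(x,\mathcal{F})\le c\,\mathrm{dist}(x,\mathcal{K})$ for all $x\in\mathrm{span}\,\mathcal{F}$. Let $\mathcal{V}\subseteq\mathcal{E}$ be an affine space with $\mathcal{K}\cap\mathcal{V}\ne\emptyset$, and write $S^\perp=\{y:\langle y,s\rangle=0\ \forall s\in S\}$ and $S^*=\{y:\langle y,s\rangle\ge0\ \forall s\in S\}$. Let $\mathcal{F}_\ell\subsetneq\cdots\subsetneq\mathcal{F}_1=\mathcal{K}$ $(\ell\ge1)$ be a chain of faces of $\mathcal{K}$ with vectors $z_i\in\mathcal{F}_i^*\cap\mathcal{V}^\perp$ such that $\mathcal{F}_{i+1}=\mathcal{F}_i\cap\{z_i\}^\perp$ for $1\le i<\ell$. Assume that $\mathcal{F}_\ell,\mathcal{V}$ satisfy the partial polyhedral Slater condition: $\mathcal{F}_\ell$ is a direct product $P\times\tilde{\mathcal{F}}$ of a polyhedral cone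 $P$ and a convex cone $\tilde{\mathcal{F}}$ (along a direct sum decomposition of $\mathcal{E}$) with $(P\times\mathrm{ri}\,\tilde{\mathcal{F}})\cap\mathcal{V}\neq\emptyset$. For $1\le i<\ell$ let $\psi_i:\mathbb{R}_+\times\mathbb{R}_+\to\mathbb{R}_+$ be a \emph{facial residual function} for $\mathcal{F}_i,z_i$: $\psi_i$ is nondecreasing in each argument, $\psi_i(0,b)=0$ for all $b\ge0$, and whenever $\varepsilon\ge0$ and $x\in\mathrm{span}\,\mathcal{K}$ satisfy $\mathrm{dist}(x,\mathcal{K})\le\varepsilon$, $\langle x,z_i\rangle\le\varepsilon$ and $\mathrm{dist}(x,\mathrm{span}\,\mathcal{F}_i)\le\varepsilon$, then $\mathrm{dist}(x,\mathcal{F}_i\cap\{z_i\}^\perp)\le\psi_i(\varepsilon,\|x\|)$. A positive rescaling of $\psi_i$ is a function $\tilde\psi_i(a,b)=M_3\,\psi_i(M_1a,M_2b)$ with constants $M_1,M_2,M_3>0$ (which may depend on $i$). For functions $f,g$ put $(f\diamondsuit g)(a,b)=f(a+g(a,b),b)$. Given positive rescalings $\tilde\psi_i$, let $\varphi=\tilde\psi_{\ell-1}\diamondsuit(\cdots\diamondsuit(\tilde\psi_2\diamondsuit\tilde\psi_1))$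 if $\ell\ge2$, and $\varphi(a,b)=a$ if $\ell=1$. Consider, for a constant $\kappa>0$, the error bound $$\mathrm{dist}(x,\mathcal{K}\cap\mathcal{V})\le(\kappa\|x\|+\kappa)\bigl(\varepsilon+\varphi(\varepsilon,\|x\|)\bigr)\quad\text{whenever } x\in\mathrm{span}\,\mathcal{K},\ \varepsilon\ge 0,\ \mathrm{dist}(x,\mathcal{K})\le\varepsilon,\ \mathrm{dist}(x,\mathcal{V})\le\varepsilon.\tag{$*$}$$ Then: (1) there are positive rescalings $\tilde\psi_i$ of the $\psi_i$ and a constant $\kappa>0$ for which $(*)$ holds; (2) for all positive rescalings $\tilde\psi_i$ of the $\psi_i$ and all $\kappa>0$ for which $(*)$ holds, if $\varphi(\cdot,b)$ is right-continuous at $0$ for every $b\ge0$, then $\Phi(a,b):=(\kappa b+\kappa)(a+\varphi(a,b))$ is a strict consistent error bound function for $\mathcal{K}$ and $\mathcal{V}$. That is, $\mathrm{dist}(x,\mathcal{K}\cap\mathcal{V})\le\Phi(\max\{\mathrm{dist}(x,\mathcal{K}),\mathrm{dist}(x,\mathcal{V})\},\|x\|)$ for all $x\in\mathcal{E}$; for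 every $b\ge0$ the function $\Phi(\cdot,b)$ is nondecreasing on $[0,\infty)$, right-continuous at $0$ and satisfies $\Phi(0,b)=0$; for every $a\ge0$ the function $\Phi(a,\cdot)$ is nondecreasing on $[0,\infty)$; and for every $b>0$ the function $\Phi(\cdot,b)$ is strictly increasing on $[0,\infty)$. -/

import Mathlib

open scoped NNReal Topology

noncomputable section

/-- `Φ : [0,∞) × [0,∞) → [0,∞)` is a consistent error bound function for the sets `C i`
(closed convex sets with a common point, in the situations of interest). -/
structure IsConsistentErrorBound {E : Type*} [NormedAddCommGroup E] {ι : Type*} [Fintype ι]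
    (C : ι → Set E) (Φ : ℝ≥0 → ℝ≥0 → ℝ≥0) : Prop where
  error_bound : ∀ x : E, Metric.infNndist x (⋂ i, C i) ≤
    Φ (Finset.univ.sup fun i => Metric.infNndist x (C i)) ‖x‖₊
  mono_left : ∀ b : ℝ≥0, Monotone fun a => Φ a b
  rightCont_zero : ∀ b : ℝ≥0, ContinuousWithinAt (fun a => Φ a b) (Set.Ioi 0) 0
  apply_zero : ∀ b : ℝ≥0, Φ 0 b = 0
  mono_right : ∀ a : ℝ≥0, Monotone fun b => Φ a b

/-- A strict consistent error bound function: `Φ(·, b)` is strictly increasing for `b > 0`. -/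
structure IsStrictConsistentErrorBound {E : Type*} [NormedAddCommGroup E] {ι : Type*} [Fintype ι]
    (C : ι → Set E) (Φ : ℝ≥0 → ℝ≥0 → ℝ≥0) : Prop extends IsConsistentErrorBound C Φ where
  strictMono_left : ∀ b : ℝ≥0, 0 < b → StrictMono fun a => Φ a b

/-- A positive rescaling of `ψ`: `ψ'(a, b) = M₃ ψ(M₁ a, M₂ b)` with `M₁, M₂, M₃ > 0`. -/
def IsPositiveRescaling (ψ' ψ : ℝ≥0 → ℝ≥0 → ℝ≥0) : Prop :=
  ∃ M₁ M₂ M₃ : ℝ≥0, 0 < M₁ ∧ 0 < M₂ ∧ 0 < M₃ ∧ ∀ a b, ψ' a b = M₃ * ψ (M₁ * a) (M₂ * b)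

/-- The diamond composition `(ψ₂ ♢ ψ₁)(a, b) = ψ₂(a + ψ₁(a, b), b)`. -/
def diamond (ψ₂ ψ₁ : ℝ≥0 → ℝ≥0 → ℝ≥0) : ℝ≥0 → ℝ≥0 → ℝ≥0 :=
  fun a b => ψ₂ (a + ψ₁ a b) b

/-- The iterated composition `ψₙ ♢ (⋯ ♢ (ψ₂ ♢ ψ₁))` of `n` functions (indexed from `0` here);
for `n = 0` it is the function `(a, b) ↦ a`. -/
def diamondComp : (n : ℕ) → (Fin n → ℝ≥0 → ℝ≥0 → ℝ≥0) → ℝ≥0 → ℝ≥0 → ℝ≥0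
  | 0, _ => fun a _ => a
  | 1, ψ => ψ 0
  | n + 2, ψ => diamond (ψ (Fin.last (n + 1))) (diamondComp (n + 1) fun i => ψ i.castSucc)

section Cones

variable {E : Type*} [NormedAddCommGroup E] [InnerProductSpace ℝ E]

/-- `K` is amenable: for every face `F` there is `κ` with `dist(x, F) ≤ κ dist(x, K)` on
`span F`. -/
def IsAmenable (K : PointedCone ℝ E) : Prop :=
  ∀ F : PointedCone ℝ E, F.IsFaceOf K → ∃ κ : ℝ≥0, ∀ x ∈ Submodule.span ℝ (F : Set E),
    Metric.infNndist x (F : Set E) ≤ κ * Metric.infNndist x (K : Set E)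

/-- `ψ` is a facial residual function for the face `F` of `K` and `z ∈ F*`. -/
structure IsFacialResidual (K F : PointedCone ℝ E) (z : E) (ψ : ℝ≥0 → ℝ≥0 → ℝ≥0) : Prop where
  mono_left : ∀ b, Monotone fun a => ψ a b
  mono_right : ∀ a, Monotone fun b => ψ a b
  apply_zero : ∀ b, ψ 0 b = 0
  residual : ∀ (x : E) (ε : ℝ≥0), x ∈ Submodule.span ℝ (K : Set E) →
    Metric.infNndist x (K : Set E) ≤ ε → inner ℝ x z ≤ (ε : ℝ) →
    Metric.infNndist x (Submodule.span ℝ (F : Set E) : Set E) ≤ ε →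
    Metric.infNndist x ((F : Set E) ∩ {y | inner ℝ y z = 0}) ≤ ψ ε ‖x‖₊

/-- A facial reduction chain of length `n + 1` for `K` and `V` (listed from `F 0 = K` down to
`F (Fin.last n)`) with reducing directions `z i ∈ (F i)* ∩ V^⊥`. -/
structure IsFacialChain [CompleteSpace E] (K : PointedCone ℝ E) (V : AffineSubspace ℝ E) {n : ℕ}
    (F : Fin (n + 1) → PointedCone ℝ E) (z : Fin n → E) : Prop where
  isFace : ∀ i, (F i).IsFaceOf K
  zero_eq : F 0 = K
  lt : ∀ i : Fin n, F i.succ < F i.castSucc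
  mem_dual : ∀ i : Fin n, z i ∈ ProperCone.innerDual (F i.castSucc : Set E)
  mem_orthogonal : ∀ i : Fin n, z i ∈ (Submodule.span ℝ (V : Set E))ᗮ
  succ_eq : ∀ i : Fin n,
    (F i.succ : Set E) = (F i.castSucc : Set E) ∩ {x | inner ℝ x (z i) = 0}

/-- The partial polyhedral Slater condition: `F` is a direct product `P × G` (along a direct sum
decomposition `E = E₁ ⊕ E₂`) with `P` a polyhedral cone, and `P × ri G` meets `V`. -/
def PartialPolyhedralSlater (F : PointedCone ℝ E) (V : AffineSubspace ℝ E) : Prop :=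
  ∃ (E₁ E₂ : Submodule ℝ E) (P G : PointedCone ℝ E), IsCompl E₁ E₂ ∧
    (P : Set E) ⊆ E₁ ∧ (G : Set E) ⊆ E₂ ∧ P.DualFG (innerₗ E) ∧ F = P ⊔ G ∧
    ∃ p ∈ P, ∃ g ∈ intrinsicInterior ℝ (G : Set E), p + g ∈ V

/-- The data `(ψ', κ)` realize the error bound for `K` and `V` built from `ψ`: each `ψ' i` is a
positive rescaling of `ψ i`, `κ > 0`, and with `φ = diamondComp n ψ'` one has
`dist(x, K ∩ V) ≤ (κ‖x‖ + κ)(ε + φ(ε, ‖x‖))` for every `x ∈ span K` with `dist(x, K) ≤ ε` and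
`dist(x, V) ≤ ε`. -/
structure RealizesErrorBound (K : PointedCone ℝ E) (V : AffineSubspace ℝ E) {n : ℕ}
    (ψ ψ' : Fin n → ℝ≥0 → ℝ≥0 → ℝ≥0) (κ : ℝ≥0) : Prop where
  rescaling : ∀ i, IsPositiveRescaling (ψ' i) (ψ i)
  pos : 0 < κ
  bound : ∀ (x : E) (ε : ℝ≥0), x ∈ Submodule.span ℝ (K : Set E) →
    Metric.infNndist x (K : Set E) ≤ ε → Metric.infNndist x (V : Set E) ≤ ε →
    Metric.infNndist x ((K : Set E) ∩ (V : Set E)) ≤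
      (κ * ‖x‖₊ + κ) * (ε + diamondComp n ψ' ε ‖x‖₊)

end Cones

end

/-!
The iterated function `φ = ψ'ₙ ♢ (⋯ ♢ ψ'₁)` bounds the distance from `x` to the last face of the
chain. Indeed, since `z i ⊥ span V`, the number `⟪x, z i⟫` is at most `‖z i‖ dist(x, V)`, and
`dist(x, span (F i)) ≤ dist(x, F i)`, so each facial residual function turns a bound on
`dist(x, F i)` into one on `dist(x, F (i + 1))`. The only rescaling needed is
`ψ' i (a, b) = ψ i (max 1 ‖z i‖ * a, b)`; see `IsFacialChain.infNndist_last_le`.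

It remains to compare `dist(x, F ∩ V)` with `dist(x, F) + dist(x, V)` when `F = P × G` and `V`
satisfy the partial polyhedral Slater condition
(`PartialPolyhedralSlater.exists_infNndist_inter_le`). This takes two steps.

* The cone `P × span G` is polyhedral, so Hoffman's error bound
  (`exists_norm_sub_le_of_finite_halfspaces`) gives a point `y₀` of `(P × span G) ∩ V` at distance
  `O(dist(x, F) + dist(x, V))` from `x`. Hoffman's bound is proved by compactness. If `y` is the
  projection of `v ∈ V` onto the polyhedron, then `v - y` lies in the polar of one of the finitely
  many tangent cones, and a unit vector in such a polar violates one of the active constraints by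
  an amount bounded away from zero.
* A Slater point `s = p + g` has `g + (ball of radius r) ∩ span G ⊆ G`. A convex combination
  of `y₀` and `s`, with weight on `s` at most a constant times the distance from `y₀` to a given
  point of `F`, is then in `F ∩ V`. The length of this move is that weight times `‖y₀ - s‖`, whence
  the factor `κ‖x‖ + κ`.

The second assertion of the theorem is a formal consequence of the monotonicity of the `ψ i`.
-/

/-! ### Hoffman's error bound -/

section Hoffman

variable {E : Type*} [NormedAddCommGroup E] [InnerProductSpace ℝ E] [FiniteDimensional ℝ E]
  {ι : Type*}

/-- A vector of the polar, relative to a subspace `D`, of the polyhedral cone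
`{d ∈ D | ∀ j ∈ J, 0 ≤ ℓ j d}` violates the constraints defining that cone by an amount
proportional to its norm. -/
theorem exists_pos_mul_norm_le_sum_of_mem_polar (ℓ : ι → E →L[ℝ] ℝ) (D : Submodule ℝ E)
    (J : Finset ι) :
    ∃ c : ℝ, 0 < c ∧ ∀ u ∈ D, (∀ d ∈ D, (∀ j ∈ J, 0 ≤ ℓ j d) → inner ℝ u d ≤ 0) →
      c * ‖u‖ ≤ ∑ j ∈ J, max (-ℓ j u) 0 := by
  set S : Set E := Metric.sphere 0 1 ∩ ((D : Set E) ∩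
    {u | ∀ d ∈ D, (∀ j ∈ J, 0 ≤ ℓ j d) → inner ℝ u d ≤ 0}) with hS
  have hcl : IsClosed {u : E | ∀ d ∈ D, (∀ j ∈ J, 0 ≤ ℓ j d) → inner ℝ u d ≤ 0} := by
    simp only [Set.ofPred_forall]
    refine isClosed_iInter fun d => isClosed_iInter fun _ => isClosed_iInter fun _ => ?_
    exact isClosed_le (by fun_prop) continuous_const
  have hcomp : IsCompact S :=
    (isCompact_sphere 0 1).inter_right (D.closed_of_finiteDimensional.inter hcl)
  have hcont : Continuous fun u => ∑ j ∈ J, max (-ℓ j u) 0 := by fun_prop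
  have hpos : ∀ u ∈ S, 0 < ∑ j ∈ J, max (-ℓ j u) 0 := by
    rintro u ⟨hu1, huD, hupol⟩
    by_contra hle
    have hz := (Finset.sum_eq_zero_iff_of_nonneg fun j _ => le_max_right (-ℓ j u) 0).1
      (le_antisymm (not_lt.1 hle) (Finset.sum_nonneg fun j _ => le_max_right _ _))
    -- Otherwise `u` would lie both in the cone and in its polar.
    have h0 : inner ℝ u u ≤ (0 : ℝ) := hupol u huD fun j hj => by
      have := le_max_left (-ℓ j u) 0
      rw [hz j hj] at this
      linarith
    rw [real_inner_self_eq_norm_sq, mem_sphere_zero_iff_norm.1 hu1] at h0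
    norm_num at h0
  obtain ⟨c, hc, hcS⟩ := hcomp.exists_forall_le' hcont.continuousOn hpos
  refine ⟨c, hc, fun u huD hupol => ?_⟩
  rcases eq_or_ne u 0 with rfl | hu
  · simp
  have hn : 0 < ‖u‖ := norm_pos_iff.2 hu
  have key := hcS (‖u‖⁻¹ • u) ⟨by simp [norm_smul, hn.ne'], D.smul_mem _ huD, fun d hd hj => by
    rw [real_inner_smul_left]
    exact mul_nonpos_of_nonneg_of_nonpos (by positivity) (hupol d hd hj)⟩
  have hsum : ∑ j ∈ J, max (-ℓ j (‖u‖⁻¹ • u)) 0 = ‖u‖⁻¹ * ∑ j ∈ J, max (-ℓ j u) 0 := by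
    rw [Finset.mul_sum]
    refine Finset.sum_congr rfl fun j _ => ?_
    rw [mul_max_of_nonneg _ _ (by positivity)]
    simp
  rw [hsum] at key
  calc c * ‖u‖ ≤ (‖u‖⁻¹ * ∑ j ∈ J, max (-ℓ j u) 0) * ‖u‖ := by gcongr
    _ = _ := by field_simp

/-- The projection `y` of `v` onto a polyhedron inside an affine subspace `V`: the vector `v - y` is
polar to the cone cut out by the constraints active at `y`. -/
theorem exists_polar_projection [Finite ι] (ℓ : ι → E →L[ℝ] ℝ) (V : AffineSubspace ℝ E)
    (hne : ∃ s ∈ V, ∀ i, 0 ≤ ℓ i s) (v : E) :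
    ∃ y ∈ V, (∀ i, 0 ≤ ℓ i y) ∧ ∀ d ∈ V.direction,
      (∀ j, ℓ j y = 0 → 0 ≤ ℓ j d) → inner ℝ (v - y) d ≤ 0 := by
  set S : Set E := (V : Set E) ∩ {x | ∀ i, 0 ≤ ℓ i x} with hS
  have hSne : S.Nonempty := hne
  have hSclosed : IsClosed S := by
    refine V.closed_of_finiteDimensional.inter ?_
    simp only [Set.ofPred_forall]
    exact isClosed_iInter fun i => isClosed_le continuous_const (ℓ i).continuous
  have hSconv : Convex ℝ S := by
    refine V.convex.inter ?_
    simp only [Set.ofPred_forall]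
    exact convex_iInter fun i => convex_halfSpace_ge (ℓ i).toLinearMap.isLinear 0
  obtain ⟨y, hy, hymin⟩ :=
    exists_norm_eq_iInf_of_complete_convex hSne hSclosed.isComplete hSconv v
  rw [norm_eq_iInf_iff_real_inner_le_zero hSconv hy] at hymin
  refine ⟨y, hy.1, hy.2, fun d hd hact => ?_⟩
  have hev : ∀ᶠ t : ℝ in 𝓝[>] 0, ∀ i, 0 ≤ ℓ i (y + t • d) := by
    refine Filter.eventually_all.2 fun i => ?_
    rcases (hy.2 i).eq_or_lt with h0 | hpos
    · filter_upwards [self_mem_nhdsWithin] with t ht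
      rw [map_add, ← h0, map_smul, zero_add]
      exact mul_nonneg (le_of_lt ht) (hact i h0.symm)
    · have hc : Continuous fun t : ℝ => ℓ i (y + t • d) := by fun_prop
      have : ∀ᶠ t : ℝ in 𝓝 0, 0 < ℓ i (y + t • d) :=
        hc.continuousAt.eventually_const_lt (by simpa using hpos)
      exact (this.filter_mono nhdsWithin_le_nhds).mono fun t ht => ht.le
  obtain ⟨t, ht, htpos⟩ := (hev.and self_mem_nhdsWithin).exists
  have hmem : y + t • d ∈ V := by
    rw [add_comm]
    exact AffineSubspace.vadd_mem_of_mem_direction (V.direction.smul_mem t hd) hy.1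
  have := hymin (y + t • d) ⟨hmem, ht⟩
  rw [add_sub_cancel_left, real_inner_smul_right] at this
  exact nonpos_of_mul_nonpos_right this htpos

/-- **Hoffman's error bound** for a finite intersection of homogeneous halfspaces and an affine
subspace. -/
theorem exists_norm_sub_le_of_finite_halfspaces [Finite ι] (ℓ : ι → E →L[ℝ] ℝ)
    (V : AffineSubspace ℝ E) (hne : ∃ s ∈ V, ∀ i, 0 ≤ ℓ i s) :
    ∃ c : ℝ, 0 ≤ c ∧ ∀ v ∈ V, ∀ w, (∀ i, 0 ≤ ℓ i w) →
      ∃ y ∈ V, (∀ i, 0 ≤ ℓ i y) ∧ ‖v - y‖ ≤ c * ‖v - w‖ := by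
  classical
  have := Fintype.ofFinite ι
  choose c hc hcle using exists_pos_mul_norm_le_sum_of_mem_polar ℓ V.direction
  refine ⟨(∑ J, (c J)⁻¹) * ∑ i, ‖ℓ i‖, mul_nonneg
    (Finset.sum_nonneg fun J _ => (inv_pos.2 (hc J)).le)
    (Finset.sum_nonneg fun i _ => norm_nonneg _), fun v hv w hw => ?_⟩
  obtain ⟨y, hyV, hy, hpol⟩ := exists_polar_projection ℓ V hne v
  refine ⟨y, hyV, hy, ?_⟩
  set J : Finset ι := Finset.univ.filter fun j => ℓ j y = 0 with hJ
  have h1 : c J * ‖v - y‖ ≤ ∑ j ∈ J, max (-ℓ j (v - y)) 0 :=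
    hcle J (v - y) (AffineSubspace.vsub_mem_direction hv hyV) fun d hd hd' =>
      hpol d hd fun j hj => hd' j (by simp [hJ, hj])
  have h2 : ∑ j ∈ J, max (-ℓ j (v - y)) 0 ≤ (∑ i, ‖ℓ i‖) * ‖v - w‖ := by
    rw [Finset.sum_mul]
    refine (Finset.sum_le_sum fun j hj => ?_).trans
      (Finset.sum_le_sum_of_subset_of_nonneg (Finset.subset_univ J)
        fun j _ _ => mul_nonneg (norm_nonneg (ℓ j)) (norm_nonneg (v - w)))
    refine max_le ?_ (by positivity)
    have hj0 : ℓ j y = 0 := by simpa [hJ] using hj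
    have h3 : ‖ℓ j (v - w)‖ ≤ ‖ℓ j‖ * ‖v - w‖ := (ℓ j).le_opNorm _
    have h4 := neg_le_of_abs_le h3
    have h5 := hw j
    simp only [map_sub] at h4 ⊢
    linarith
  have h3 : (c J)⁻¹ ≤ ∑ J, (c J)⁻¹ :=
    Finset.single_le_sum (f := fun J => (c J)⁻¹) (fun J _ => (inv_pos.2 (hc J)).le)
      (Finset.mem_univ J)
  calc ‖v - y‖ = (c J)⁻¹ * (c J * ‖v - y‖) := by rw [inv_mul_cancel_left₀ (hc J).ne']
    _ ≤ (∑ J, (c J)⁻¹) * ((∑ i, ‖ℓ i‖) * ‖v - w‖) := by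
        exact mul_le_mul h3 (h1.trans h2) (mul_nonneg (hc J).le (norm_nonneg _))
          ((inv_pos.2 (hc J)).le.trans h3)
    _ = _ := by ring

end Hoffman

/-! ### The partial polyhedral Slater condition -/

section Slater

universe u

variable {E : Type*} [NormedAddCommGroup E] [InnerProductSpace ℝ E]

/-- The relative interior of a cone, in conic form: moving from `t • g` by at most `r * t` within
the span of the cone does not leave the cone. -/
theorem PointedCone.exists_smul_add_mem_of_mem_intrinsicInterior {G : PointedCone ℝ E} {g : E}
    (hg : g ∈ intrinsicInterior ℝ (G : Set E)) :
    ∃ r : ℝ, 0 < r ∧ ∀ u ∈ Submodule.span ℝ (G : Set E), ∀ t : ℝ, ‖u‖ ≤ r * t →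
      t • g + u ∈ G := by
  obtain ⟨⟨g, hgs⟩, hint, rfl⟩ := mem_intrinsicInterior.1 hg
  obtain ⟨r, hr, hball⟩ := Metric.mem_nhds_iff.1 (mem_interior_iff_mem_nhds.1 hint)
  have hdir : (affineSpan ℝ (G : Set E)).direction = Submodule.span ℝ (G : Set E) := by
    rw [direction_affineSpan, vectorSpan_eq_span_vsub_set_right ℝ (show (0 : E) ∈ (G : Set E) from
      G.zero_mem)]
    simp
  have hunit : ∀ u ∈ Submodule.span ℝ (G : Set E), ‖u‖ < r → g + u ∈ G := fun u hu hur => by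
    have hmem : g + u ∈ affineSpan ℝ (G : Set E) := by
      rw [add_comm]
      exact AffineSubspace.vadd_mem_of_mem_direction (hdir ▸ hu) hgs
    exact hball (show (⟨g + u, hmem⟩ : affineSpan ℝ (G : Set E)) ∈ Metric.ball _ r by
      simpa [Subtype.dist_eq, dist_eq_norm] using hur)
  -- The ball in `hunit` is open; a smaller radius allows the non-strict bound `‖u‖ ≤ r * t`.
  refine ⟨r / 2, by positivity, fun u hu t hut => ?_⟩
  rcases lt_or_ge 0 t with ht | ht
  · have h' := G.smul_mem ht.le <| hunit (t⁻¹ • u) (Submodule.smul_mem _ _ hu) (by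
      rw [norm_smul, norm_inv, Real.norm_of_nonneg ht.le, inv_mul_lt_iff₀ ht]
      nlinarith)
    rwa [smul_add, smul_inv_smul₀ ht.ne'] at h'
  · have h0 : ‖u‖ ≤ 0 := hut.trans (mul_nonpos_of_nonneg_of_nonpos (by positivity) ht)
    have hu0 : u = 0 := norm_le_zero_iff.1 h0
    have ht0 : t = 0 := by
      subst hu0
      simp only [norm_zero] at hut
      nlinarith
    simp [hu0, ht0]

variable [FiniteDimensional ℝ E]

/-- The product of a polyhedral cone and a subspace, along a pair of linear maps, is cut out by
finitely many linear functionals. -/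
theorem PointedCone.DualFG.exists_functionals {E : Type u} [NormedAddCommGroup E]
    [InnerProductSpace ℝ E] [FiniteDimensional ℝ E]
    {P : PointedCone ℝ E} (hP : P.DualFG (innerₗ E))
    (M : Submodule ℝ E) (π₁ π₂ : E →L[ℝ] E) :
    ∃ (ι : Type u) (_ : Finite ι) (ℓ : ι → E →L[ℝ] ℝ),
      ∀ x, (∀ i, 0 ≤ ℓ i x) ↔ π₁ x ∈ P ∧ π₂ x ∈ M := by
  obtain ⟨s, rfl⟩ := hP
  obtain ⟨t, ht⟩ : (Mᗮ).FG := IsNoetherian.noetherian _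
  have hM : ∀ w, w ∈ M ↔ ∀ a ∈ t, inner ℝ a w = 0 := fun w => by
    conv_lhs => rw [← M.orthogonal_orthogonal, ← ht]
    rw [Submodule.mem_orthogonal]
    refine ⟨fun h a ha => h a (Submodule.subset_span ha), fun h u hu => ?_⟩
    induction hu using Submodule.span_induction with
    | mem a ha => exact h a ha
    | zero => simp
    | add a b _ _ ha hb => rw [inner_add_left, ha, hb, add_zero]
    | smul c a _ ha => rw [real_inner_smul_left, ha, mul_zero]
  refine ⟨s ⊕ (t ⊕ t), inferInstance, Sum.elim (fun a => (innerSL ℝ a.1).comp π₁)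
    (Sum.elim (fun a => (innerSL ℝ a.1).comp π₂) (fun a => -(innerSL ℝ a.1).comp π₂)),
    fun x => ?_⟩
  rw [hM, PointedCone.mem_dual]
  simp only [Sum.forall, Sum.elim_inl, Sum.elim_inr, Subtype.forall]
  refine and_congr (by simp) ⟨fun h a ha => le_antisymm ?_ ?_, fun h => ⟨?_, ?_⟩⟩
  · simpa using h.2 a ha
  · simpa using h.1 a ha
  · intro a ha
    simp [h a ha]
  · intro a ha
    simp [h a ha]

/-- Under the partial polyhedral Slater condition, the distance to the intersection is controlled by
the sum of the distances, with a constant growing linearly in the norm. Here this is phrased with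
arbitrary points of `F` and `V` in place of nearest points. -/
theorem PartialPolyhedralSlater.exists_norm_sub_le {F : PointedCone ℝ E} {V : AffineSubspace ℝ E}
    (h : PartialPolyhedralSlater F V) :
    ∃ κ : ℝ, 0 < κ ∧ ∀ x, ∀ f ∈ F, ∀ v ∈ V, ∃ y ∈ F, y ∈ V ∧
      ‖x - y‖ ≤ (κ * ‖x‖ + κ) * (‖x - f‖ + ‖x - v‖) := by
  obtain ⟨E₁, E₂, P, G, hcompl, hPE, hGE, hP, rfl, p, hp, g, hg, hs⟩ := h
  have hgG : g ∈ G := intrinsicInterior_subset hg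
  obtain ⟨r, hr, hrG⟩ := PointedCone.exists_smul_add_mem_of_mem_intrinsicInterior hg
  set π₁ : E →L[ℝ] E := (E₁.projection E₂ hcompl).toContinuousLinearMap with hπ₁
  set π₂ : E →L[ℝ] E := (E₂.projection E₁ hcompl.symm).toContinuousLinearMap with hπ₂
  have hsum : ∀ x, π₁ x + π₂ x = x := fun x =>
    Submodule.projection_add_projection_eq_self hcompl x
  have hπ₁P : ∀ a ∈ P, ∀ b ∈ G, π₁ (a + b) = a := fun a ha b hb => by
    rw [map_add]
    simp [hπ₁, Submodule.projection_apply_of_mem_left hcompl (hPE ha),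
      (Submodule.projection_apply_eq_zero_iff hcompl).2 (hGE hb)]
  have hπ₂G : ∀ a ∈ P, ∀ b ∈ G, π₂ (a + b) = b := fun a ha b hb => by
    rw [map_add]
    simp [hπ₂, Submodule.projection_apply_of_mem_left hcompl.symm (hGE hb),
      (Submodule.projection_apply_eq_zero_iff hcompl.symm).2 (hPE ha)]
  obtain ⟨ι, hι, ℓ, hℓ⟩ := hP.exists_functionals (Submodule.span ℝ (G : Set E)) π₁ π₂
  have hW : ∀ a ∈ P, ∀ b ∈ G, ∀ i, 0 ≤ ℓ i (a + b) := fun a ha b hb => by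
    rw [hℓ, hπ₁P a ha b hb, hπ₂G a ha b hb]
    exact ⟨ha, Submodule.subset_span hb⟩
  obtain ⟨c, hc, hcle⟩ :=
    exists_norm_sub_le_of_finite_halfspaces ℓ V ⟨p + g, hs, hW p hp g hgG⟩
  set C : ℝ := ‖π₂‖ * (c + 2) / r with hC
  have hC0 : 0 ≤ C := by positivity
  refine ⟨C * (1 + ‖p + g‖) + 2 * (c + 1), by positivity, fun x f hf v hv => ?_⟩
  obtain ⟨a, ha, b, hb, rfl⟩ := Submodule.mem_sup.1 hf
  obtain ⟨y₀, hy₀V, hy₀, hle⟩ := hcle v hv (a + b) (hW a ha b hb)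
  obtain ⟨hy₁, hy₂⟩ := (hℓ y₀).1 hy₀
  set δ : ℝ := ‖x - (a + b)‖ + ‖x - v‖ with hδ
  have hvf : ‖v - (a + b)‖ ≤ δ := by
    have := norm_sub_le_norm_sub_add_norm_sub v x (a + b)
    rw [norm_sub_rev v x] at this
    linarith
  have hxv : ‖x - v‖ ≤ δ := by
    have := norm_nonneg (x - (a + b))
    linarith
  have hδ0 : 0 ≤ δ := (norm_nonneg _).trans hvf
  have hvy : ‖v - y₀‖ ≤ c * δ := hle.trans (by gcongr)
  have hxy : ‖x - y₀‖ ≤ (c + 1) * δ := by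
    have := norm_sub_le_norm_sub_add_norm_sub x v y₀
    linarith
  have hyf : ‖y₀ - (a + b)‖ ≤ (c + 2) * δ := by
    have h1 := norm_sub_le_norm_sub_add_norm_sub y₀ v (a + b)
    rw [norm_sub_rev y₀ v] at h1
    linarith
  set d : ℝ := ‖π₂ y₀ - b‖ with hd
  have hd0 : 0 ≤ d := norm_nonneg _
  have hdle : d / r ≤ C * δ := by
    have h1 : d ≤ ‖π₂‖ * ‖y₀ - (a + b)‖ := by
      rw [hd, ← hπ₂G a ha b hb, ← map_sub, hπ₂G a ha b hb]
      exact π₂.le_opNorm _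
    calc d / r ≤ ‖π₂‖ * ((c + 2) * δ) / r := by
          gcongr
          exact h1.trans (by gcongr)
      _ = C * δ := by rw [hC]; ring
  have hrd : 0 < r + d := by positivity
  -- `r • y₀ + d • s` splits into a part in `P` and the part
  -- `r • π₂ y₀ + d • g = r • b + (d • g + r • (π₂ y₀ - b))` in `G`.
  have hcone : r • y₀ + d • (p + g) ∈ P ⊔ G := by
    have hmemP : r • π₁ y₀ + d • p ∈ P :=
      P.add_mem (P.smul_mem hr.le hy₁)
        (P.smul_mem hd0 hp)
    have hmemG : r • b + (d • g + r • (π₂ y₀ - b)) ∈ G := by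
      refine G.add_mem (G.smul_mem hr.le hb) (hrG _ ?_ _ ?_)
      · exact Submodule.smul_mem _ _ (Submodule.sub_mem _ hy₂ (Submodule.subset_span hb))
      · rw [norm_smul, Real.norm_of_nonneg hr.le]
    refine Submodule.mem_sup.2 ⟨_, hmemP, _, hmemG, ?_⟩
    conv_rhs => rw [← hsum y₀]
    module
  set lam : ℝ := d / (r + d) with hlam
  have hlam0 : 0 ≤ lam := by positivity
  have hlam1 : lam ≤ 1 := by
    rw [hlam, div_le_one hrd]
    linarith
  have hlamr : lam ≤ d / r := by
    rw [hlam]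
    gcongr
    linarith
  refine ⟨AffineMap.lineMap y₀ (p + g) lam, ?_, AffineMap.lineMap_mem lam hy₀V hs, ?_⟩
  · have he : AffineMap.lineMap y₀ (p + g) lam = (r + d)⁻¹ • (r • y₀ + d • (p + g)) := by
      have h1 : 1 - lam = (r + d)⁻¹ * r := by
        rw [hlam]
        field_simp
        ring
      have h2 : lam = (r + d)⁻¹ * d := by rw [hlam, div_eq_inv_mul]
      rw [AffineMap.lineMap_apply_module, h1, h2]
      module
    rw [he]
    exact (P ⊔ G).smul_mem (inv_nonneg.2 hrd.le) hcone
  · have h1 : ‖x - AffineMap.lineMap y₀ (p + g) lam‖ ≤ ‖x - y₀‖ + lam * ‖y₀ - (p + g)‖ := by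
      have h2 := norm_sub_le_norm_sub_add_norm_sub x y₀ (AffineMap.lineMap y₀ (p + g) lam)
      rwa [← dist_eq_norm y₀ (AffineMap.lineMap _ _ _), dist_left_lineMap,
        Real.norm_of_nonneg hlam0, dist_eq_norm] at h2
    have h2 : ‖y₀ - (p + g)‖ ≤ ‖x - y₀‖ + (‖x‖ + ‖p + g‖) := by
      have h3 := norm_sub_le_norm_sub_add_norm_sub y₀ x (p + g)
      have h4 := norm_sub_le x (p + g)
      rw [norm_sub_rev y₀ x] at h3
      linarith
    have h5 : lam * ‖y₀ - (p + g)‖ ≤ ‖x - y₀‖ + C * δ * (‖x‖ + ‖p + g‖) :=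
      calc lam * ‖y₀ - (p + g)‖ ≤ lam * (‖x - y₀‖ + (‖x‖ + ‖p + g‖)) := by gcongr
        _ = lam * ‖x - y₀‖ + lam * (‖x‖ + ‖p + g‖) := by ring
        _ ≤ 1 * ‖x - y₀‖ + C * δ * (‖x‖ + ‖p + g‖) := by
            gcongr
            exact hlamr.trans hdle
        _ = _ := by ring
    calc ‖x - AffineMap.lineMap y₀ (p + g) lam‖
        ≤ (2 * (c + 1) + C * (‖x‖ + ‖p + g‖)) * δ := by linarith
      _ ≤ _ := by
        refine mul_le_mul_of_nonneg_right ?_ hδ0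
        have := mul_nonneg hC0 (mul_nonneg (norm_nonneg x) (norm_nonneg (p + g)))
        have := mul_nonneg hc (norm_nonneg x)
        have := norm_nonneg x
        linarith

theorem PartialPolyhedralSlater.exists_infNndist_inter_le {F : PointedCone ℝ E}
    {V : AffineSubspace ℝ E} (h : PartialPolyhedralSlater F V) :
    ∃ κ : ℝ≥0, 0 < κ ∧ ∀ x, Metric.infNndist x ((F : Set E) ∩ (V : Set E)) ≤
      (κ * ‖x‖₊ + κ) * (Metric.infNndist x (F : Set E) + Metric.infNndist x (V : Set E)) := by
  obtain ⟨κ, hκ, hle⟩ := h.exists_norm_sub_le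
  have hV : (V : Set E).Nonempty := by
    obtain ⟨E₁, E₂, P, G, -, -, -, -, -, p, -, g, -, hs⟩ := h
    exact ⟨_, hs⟩
  refine ⟨⟨κ, hκ.le⟩, hκ, fun x => ?_⟩
  rw [← NNReal.coe_le_coe]
  change Metric.infDist x ((F : Set E) ∩ (V : Set E)) ≤
    (κ * ‖x‖ + κ) * (Metric.infDist x (F : Set E) + Metric.infDist x (V : Set E))
  have hA : 0 < κ * ‖x‖ + κ := by positivity
  refine le_of_forall_pos_le_add fun η hη => ?_
  have hη' : 0 < η / (2 * (κ * ‖x‖ + κ)) := by positivity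
  obtain ⟨f, hf, hxf⟩ := (Metric.infDist_lt_iff (x := x) ⟨0, F.zero_mem⟩).1
    (lt_add_of_pos_right (Metric.infDist x (F : Set E)) hη')
  obtain ⟨v, hv, hxv⟩ := (Metric.infDist_lt_iff (x := x) hV).1
    (lt_add_of_pos_right (Metric.infDist x (V : Set E)) hη')
  obtain ⟨y, hyF, hyV, hy⟩ := hle x f hf v hv
  rw [dist_eq_norm] at hxf hxv
  calc Metric.infDist x ((F : Set E) ∩ (V : Set E)) ≤ dist x y :=
        Metric.infDist_le_dist_of_mem ⟨hyF, hyV⟩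
    _ ≤ (κ * ‖x‖ + κ) * (‖x - f‖ + ‖x - v‖) := by rwa [dist_eq_norm]
    _ ≤ (κ * ‖x‖ + κ) * ((Metric.infDist x (F : Set E) + η / (2 * (κ * ‖x‖ + κ))) +
          (Metric.infDist x (V : Set E) + η / (2 * (κ * ‖x‖ + κ)))) := by gcongr
    _ = _ := by field_simp; ring

end Slater

/-! ### Diamond compositions -/

section Diamond

theorem diamondComp_succ_succ (n : ℕ) (ψ : Fin (n + 2) → ℝ≥0 → ℝ≥0 → ℝ≥0) (a b : ℝ≥0) :
    diamondComp (n + 2) ψ a b = ψ (Fin.last (n + 1))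
      (a + diamondComp (n + 1) (fun i => ψ i.castSucc) a b) b :=
  rfl

theorem diamondComp_mono {n : ℕ} {ψ : Fin n → ℝ≥0 → ℝ≥0 → ℝ≥0}
    (hl : ∀ i b, Monotone fun a => ψ i a b) (hr : ∀ i a, Monotone fun b => ψ i a b)
    {a a' b b' : ℝ≥0} (ha : a ≤ a') (hb : b ≤ b') :
    diamondComp n ψ a b ≤ diamondComp n ψ a' b' := by
  match n with
  | 0 => exact ha
  | 1 => exact (hl 0 b ha).trans (hr 0 a' hb)
  | n + 2 =>
    rw [diamondComp_succ_succ, diamondComp_succ_succ]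
    exact (hl _ b (add_le_add ha
      (diamondComp_mono (fun i => hl i.castSucc) (fun i => hr i.castSucc) ha hb))).trans
      (hr _ _ hb)

theorem diamondComp_zero_left {n : ℕ} {ψ : Fin n → ℝ≥0 → ℝ≥0 → ℝ≥0}
    (h0 : ∀ i b, ψ i 0 b = 0) (b : ℝ≥0) : diamondComp n ψ 0 b = 0 := by
  match n with
  | 0 => rfl
  | 1 => exact h0 0 b
  | n + 2 =>
    rw [diamondComp_succ_succ, diamondComp_zero_left (fun i => h0 i.castSucc), add_zero, h0]

end Diamond

/-! ### Descending a chain of faces -/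

section Chain

variable {E : Type*} [NormedAddCommGroup E] [InnerProductSpace ℝ E]

theorem infNndist_span_le (F : PointedCone ℝ E) (x : E) :
    Metric.infNndist x (Submodule.span ℝ (F : Set E) : Set E) ≤ Metric.infNndist x (F : Set E) :=
  Metric.infDist_le_infDist_of_subset Submodule.subset_span ⟨0, F.zero_mem⟩

variable [FiniteDimensional ℝ E] {K : PointedCone ℝ E} {V : AffineSubspace ℝ E}

theorem IsFacialChain.init {n : ℕ} {F : Fin (n + 2) → PointedCone ℝ E} {z : Fin (n + 1) → E}
    (h : IsFacialChain K V F z) :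
    IsFacialChain K V (fun i : Fin (n + 1) => F i.castSucc) (fun i : Fin n => z i.castSucc) where
  isFace i := h.isFace i.castSucc
  zero_eq := h.zero_eq
  lt i := h.lt i.castSucc
  mem_dual i := h.mem_dual i.castSucc
  mem_orthogonal i := h.mem_orthogonal i.castSucc
  succ_eq i := h.succ_eq i.castSucc

theorem inner_le_norm_mul_infDist_of_mem_orthogonal (hV : (V : Set E).Nonempty) {z : E}
    (hz : z ∈ (Submodule.span ℝ (V : Set E))ᗮ) (x : E) :
    inner ℝ x z ≤ ‖z‖ * Metric.infDist x (V : Set E) := by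
  obtain ⟨v, hv, hvd⟩ := V.closed_of_finiteDimensional.exists_infDist_eq_dist hV x
  have h0 : inner ℝ v z = 0 := (Submodule.mem_orthogonal _ z).1 hz v (Submodule.subset_span hv)
  calc inner ℝ x z = inner ℝ (x - v) z := by rw [inner_sub_left, h0, sub_zero]
    _ ≤ ‖x - v‖ * ‖z‖ := real_inner_le_norm _ _
    _ = _ := by rw [hvd, dist_eq_norm, mul_comm]

/-- One step down the chain: a bound `δ` on the distance to the face `F i` gives a bound on the
distance to the next face. -/
theorem IsFacialChain.infNndist_succ_le {n : ℕ} {F : Fin (n + 1) → PointedCone ℝ E} {z : Fin n → E}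
    (h : IsFacialChain K V F z) (hfull : Submodule.span ℝ (K : Set E) = ⊤)
    (hV : (V : Set E).Nonempty) (i : Fin n) {ψ : ℝ≥0 → ℝ≥0 → ℝ≥0}
    (hψ : IsFacialResidual K (F i.castSucc) (z i) ψ) {x : E} {ε δ : ℝ≥0}
    (hK : Metric.infNndist x (K : Set E) ≤ ε) (hVε : Metric.infNndist x (V : Set E) ≤ ε)
    (hεδ : ε ≤ δ)
    (hF : Metric.infNndist x (Submodule.span ℝ (F i.castSucc : Set E) : Set E) ≤ δ) :
    Metric.infNndist x (F i.succ : Set E) ≤ ψ (max 1 ‖z i‖₊ * δ) ‖x‖₊ := by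
  have hM : ∀ a : ℝ≥0, a ≤ max 1 ‖z i‖₊ * a := fun a =>
    le_mul_of_one_le_left (by positivity) (le_max_left _ _)
  rw [h.succ_eq i]
  refine hψ.residual x _ (hfull ▸ Submodule.mem_top) (hK.trans (hεδ.trans (hM δ))) ?_
    (hF.trans (hM δ))
  have h1 := inner_le_norm_mul_infDist_of_mem_orthogonal hV (h.mem_orthogonal i) x
  have h2 : ‖z i‖₊ * Metric.infNndist x (V : Set E) ≤ max 1 ‖z i‖₊ * δ :=
    mul_le_mul' (le_max_right _ _) (hVε.trans hεδ)
  exact h1.trans (by exact_mod_cast h2)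

/-- Points close to both `K` and `V` are close to the last face of the chain, with the residual
given by the diamond composition of the rescaled facial residual functions. -/
theorem IsFacialChain.infNndist_last_le {n : ℕ} {F : Fin (n + 1) → PointedCone ℝ E} {z : Fin n → E}
    (h : IsFacialChain K V F z) (hfull : Submodule.span ℝ (K : Set E) = ⊤)
    (hV : (V : Set E).Nonempty) {ψ : Fin n → ℝ≥0 → ℝ≥0 → ℝ≥0}
    (hψ : ∀ i : Fin n, IsFacialResidual K (F i.castSucc) (z i) (ψ i)) {x : E} {ε : ℝ≥0}
    (hK : Metric.infNndist x (K : Set E) ≤ ε) (hVε : Metric.infNndist x (V : Set E) ≤ ε) :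
    Metric.infNndist x (F (Fin.last n) : Set E) ≤
      diamondComp n (fun i a b => ψ i (max 1 ‖z i‖₊ * a) b) ε ‖x‖₊ := by
  match n with
  | 0 =>
    have h0 : F (Fin.last 0) = K := h.zero_eq
    rw [h0]
    exact hK
  | 1 =>
    refine h.infNndist_succ_le hfull hV 0 (hψ 0) hK hVε le_rfl ((infNndist_span_le _ x).trans ?_)
    have h0 : F (Fin.castSucc 0) = K := h.zero_eq
    rwa [h0]
  | n + 2 =>
    have ih := h.init.infNndist_last_le hfull hV (fun i => hψ i.castSucc) hK hVε
    exact h.infNndist_succ_le hfull hV (Fin.last (n + 1)) (hψ _) hK hVε le_self_add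
      ((infNndist_span_le _ x).trans (ih.trans le_add_self))

end Chain

/-! ### The error bound and its consistency -/

theorem mainTheorem11 {E : Type*} [NormedAddCommGroup E] [InnerProductSpace ℝ E]
    [FiniteDimensional ℝ E]
    (K : PointedCone ℝ E) (hclosed : IsClosed (K : Set E))
    (hfull : Submodule.span ℝ (K : Set E) = ⊤) (hamen : IsAmenable K)
    (V : AffineSubspace ℝ E) (hKV : ((K : Set E) ∩ (V : Set E)).Nonempty)
    (n : ℕ) (F : Fin (n + 1) → PointedCone ℝ E) (z : Fin n → E)
    (hchain : IsFacialChain K V F z) (hpps : PartialPolyhedralSlater (F (Fin.last n)) V)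
    (ψ : Fin n → ℝ≥0 → ℝ≥0 → ℝ≥0)
    (hψ : ∀ i : Fin n, IsFacialResidual K (F i.castSucc) (z i) (ψ i)) :
    (∃ (ψ' : Fin n → ℝ≥0 → ℝ≥0 → ℝ≥0) (κ : ℝ≥0), RealizesErrorBound K V ψ ψ' κ) ∧
    ∀ (ψ' : Fin n → ℝ≥0 → ℝ≥0 → ℝ≥0) (κ : ℝ≥0), RealizesErrorBound K V ψ ψ' κ →
      (∀ b : ℝ≥0, ContinuousWithinAt (fun a => diamondComp n ψ' a b) (Set.Ioi 0) 0) →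
      IsStrictConsistentErrorBound ![(K : Set E), (V : Set E)]
        (fun a b => (κ * b + κ) * (a + diamondComp n ψ' a b)) := by
  refine ⟨?_, fun ψ' κ hreal hcont => ?_⟩
  · obtain ⟨κ, hκ, hle⟩ := hpps.exists_infNndist_inter_le
    refine ⟨fun i a b => ψ i (max 1 ‖z i‖₊ * a) b, κ,
      fun i => ⟨max 1 ‖z i‖₊, 1, 1, by positivity, one_pos, one_pos, fun a b => by simp⟩, hκ,
      fun x ε _ hK hVε => ?_⟩
    have hFK : (F (Fin.last n) : Set E) ⊆ K := (hchain.isFace _).le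
    have hne : ((F (Fin.last n) : Set E) ∩ (V : Set E)).Nonempty := by
      obtain ⟨E₁, E₂, P, G, -, -, -, -, hF, p, hp, g, hg, hs⟩ := hpps
      exact ⟨p + g, hF ▸ Submodule.add_mem_sup hp (intrinsicInterior_subset hg), hs⟩
    calc Metric.infNndist x ((K : Set E) ∩ (V : Set E))
        ≤ Metric.infNndist x ((F (Fin.last n) : Set E) ∩ (V : Set E)) :=
          Metric.infDist_le_infDist_of_subset (Set.inter_subset_inter_left _ hFK) hne
      _ ≤ _ := hle x
      _ ≤ _ := by
        rw [add_comm ε]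
        gcongr
        exact hchain.infNndist_last_le hfull hKV.right hψ hK hVε
  · have hl : ∀ i b, Monotone fun a => ψ' i a b := fun i b a a' ha => by
      obtain ⟨M₁, M₂, M₃, -, -, -, hM⟩ := hreal.rescaling i
      simp only [hM]
      exact mul_le_mul_right ((hψ i).mono_left _ (mul_le_mul_right ha M₁)) M₃
    have hr : ∀ i a, Monotone fun b => ψ' i a b := fun i a b b' hb => by
      obtain ⟨M₁, M₂, M₃, -, -, -, hM⟩ := hreal.rescaling i
      simp only [hM]
      exact mul_le_mul_right ((hψ i).mono_right _ (mul_le_mul_right hb M₂)) M₃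
    have h0 : ∀ i b, ψ' i 0 b = 0 := fun i b => by
      obtain ⟨M₁, M₂, M₃, -, -, -, hM⟩ := hreal.rescaling i
      rw [hM, mul_zero, (hψ i).apply_zero, mul_zero]
    refine ⟨⟨fun x => ?_, fun b a a' ha => ?_, fun b => ?_, fun b => ?_, fun a b b' hb => ?_⟩,
      fun b hb a a' ha => ?_⟩
    · have hinter : ⋂ i, (![(K : Set E), (V : Set E)] : Fin 2 → Set E) i =
          (K : Set E) ∩ (V : Set E) := by
        ext y
        simp [Fin.forall_fin_two]
      rw [hinter]
      have hdist := fun i => Finset.le_sup (s := Finset.univ)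
        (f := fun i => Metric.infNndist x (![(K : Set E), (V : Set E)] i)) (Finset.mem_univ i)
      have hx : x ∈ Submodule.span ℝ (K : Set E) := by
        rw [hfull]
        exact Submodule.mem_top
      exact hreal.bound x _ hx (hdist 0) (hdist 1)
    · exact mul_le_mul_right (add_le_add ha (diamondComp_mono hl hr ha le_rfl)) _
    · exact continuousWithinAt_const.mul (continuousWithinAt_id.add (hcont b))
    · simp only [diamondComp_zero_left h0, add_zero, mul_zero]
    · exact mul_le_mul' (add_le_add (mul_le_mul_right hb κ) le_rfl)
        (add_le_add le_rfl (diamondComp_mono hl hr le_rfl hb))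
    · have hκ := hreal.pos
      exact mul_lt_mul_of_pos_left
        (add_lt_add_of_lt_of_le ha (diamondComp_mono hl hr ha.le le_rfl)) (by positivity)
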